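/- Let $\mathbb D=\{z\in\mathbb C:|z|<1\}$. Let $\mathcal U$ be the class of functions $f$ that are analytic in $\mathbb D$, of the form $$f(z)=z+a_2z^2+a_3z^3+\cdots ,$$ and satisfy $$\left|\left(\frac{z}{f(z)}\right)^2f'(z)-1\right|<1\qquad(z\in\mathbb D)$$ (in particular $f(z)\neq0$ for $0<|z|<1$, and $z/f(z)$ is given its limit $1$ at $z=0$). Then every $f\in\mathcal U$ satisfies (i) $|a_2a_3-a_4|\le 2$; (ii) $|a_2a_4-a_5|\le 3$. Both inequalities are sharp: the Koebe function $k(z)=\dfrac{z}{(1-z)^2}=z+\sum_{n=2}^{\infty}nz^n$ $(z\in\mathbb D)$ and all its rotations $z\mapsto e^{-i\theta}k(e^{i\theta}z)$, $\theta\in\mathbb R$, belong to $\mathcal U$, and equality holds for each of them in both (i) and (ii). -/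

import Mathlib

/-- The `n`-th Taylor coefficient `a_n` of `f` at the origin. -/
noncomputable def taylorCoeff (f : ℂ → ℂ) (n : ℕ) : ℂ :=
  iteratedDeriv n f 0 / (n.factorial : ℂ)

/-- The class `𝒜`: functions analytic in the open unit disk, normalized so that
`f z = z + a₂ z² + a₃ z³ + ⋯`. -/
structure ClassA (f : ℂ → ℂ) : Prop where
  analytic : AnalyticOnNhd ℂ f (Metric.ball 0 1)
  map_zero : f 0 = 0
  deriv_zero : deriv f 0 = 1

/-- The class `𝒰`: functions of class `𝒜` with `|(z / f z)² f' z - 1| < 1` in the unit disk.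
The quotient `z / f z` has to be defined, so `f` has no zero in the punctured disk; at the origin
`z / f z` is read as its limit `1`, so that the expression `(z / f z)² f' z - 1` is `0` there
and the inequality holds automatically. -/
structure ClassU (f : ℂ → ℂ) : Prop extends ClassA f where
  ne_zero : ∀ z ∈ Metric.ball (0 : ℂ) 1, z ≠ 0 → f z ≠ 0
  norm_lt : ∀ z ∈ Metric.ball (0 : ℂ) 1, z ≠ 0 → ‖(z / f z) ^ 2 * deriv f z - 1‖ < 1

/-- The Koebe function. -/
noncomputable def koebe (z : ℂ) : ℂ := z / (1 - z) ^ 2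

/-- The rotation `z ↦ e^{-iθ} f (e^{iθ} z)` of `f`. -/
noncomputable def diskRotation (θ : ℝ) (f : ℂ → ℂ) (z : ℂ) : ℂ :=
  Complex.exp (-(θ * Complex.I)) * f (Complex.exp (θ * Complex.I) * z)

/-! Put `p = z / f = 1 + p₁ z + p₂ z² + ⋯`. Then `(z / f)² f' = p - z p'`, so membership in the
class says that `E = p - z p' - 1 = -∑ (n - 1) pₙ zⁿ` has modulus below one. It vanishes to order
two, so by Schwarz `E = z² φ` with `|φ| ≤ 1`, and coefficient bounds for `φ` give `|p₂| ≤ 1`, `2|p₃|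
≤ 1 - |p₂|²`, `3|p₄| ≤ 1 - |p₂|²`. Comparing coefficients in `(f / z) p = 1` gives `a₂a₃ - a₄ = p₂a₂
+ p₃` and `a₂a₄ - a₅ = p₂a₃ + p₃a₂ + p₄`, so only `|a₂| ≤ 2` and `|a₃| ≤ 3` are still needed. They
follow from `p = (1 + w)²` with `w` a Schwarz function (`exists_eq_one_add_sq`), which is proved
with Jack's lemma. -/

open Filter Topology

/-! ### Calculus of Taylor coefficients at the origin. -/

theorem taylorCoeff_congr {f g : ℂ → ℂ} (h : f =ᶠ[𝓝 0] g) (n : ℕ) :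
    taylorCoeff f n = taylorCoeff g n := by
  rw [taylorCoeff, taylorCoeff, h.iteratedDeriv_eq]

theorem taylorCoeff_zero (f : ℂ → ℂ) : taylorCoeff f 0 = f 0 := by
  simp [taylorCoeff]

theorem taylorCoeff_one (f : ℂ → ℂ) : taylorCoeff f 1 = deriv f 0 := by
  simp [taylorCoeff]

theorem taylorCoeff_add {f g : ℂ → ℂ} (hf : AnalyticAt ℂ f 0) (hg : AnalyticAt ℂ g 0) (n : ℕ) :
    taylorCoeff (fun z => f z + g z) n = taylorCoeff f n + taylorCoeff g n := by
  rw [taylorCoeff, iteratedDeriv_fun_add hf.contDiffAt hg.contDiffAt, add_div]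
  rfl

theorem taylorCoeff_sub {f g : ℂ → ℂ} (hf : AnalyticAt ℂ f 0) (hg : AnalyticAt ℂ g 0) (n : ℕ) :
    taylorCoeff (fun z => f z - g z) n = taylorCoeff f n - taylorCoeff g n := by
  rw [taylorCoeff, iteratedDeriv_fun_sub hf.contDiffAt hg.contDiffAt, sub_div]
  rfl

theorem taylorCoeff_const (c : ℂ) (n : ℕ) :
    taylorCoeff (fun _ => c) n = if n = 0 then c else 0 := by
  rw [taylorCoeff, iteratedDeriv_const]
  split_ifs with h <;> simp [h]

theorem taylorCoeff_const_mul (c : ℂ) (f : ℂ → ℂ) (n : ℕ) :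
    taylorCoeff (fun z => c * f z) n = c * taylorCoeff f n := by
  rw [taylorCoeff, iteratedDeriv_const_mul_field, mul_div_assoc]
  rfl

theorem taylorCoeff_mul {f g : ℂ → ℂ} (hf : AnalyticAt ℂ f 0) (hg : AnalyticAt ℂ g 0) (n : ℕ) :
    taylorCoeff (fun z => f z * g z) n =
      ∑ i ∈ Finset.range (n + 1), taylorCoeff f i * taylorCoeff g (n - i) := by
  rw [taylorCoeff, iteratedDeriv_fun_mul hf.contDiffAt hg.contDiffAt, Finset.sum_div]
  refine Finset.sum_congr rfl fun i hi => ?_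
  have hi : i ≤ n := Nat.lt_succ_iff.1 (Finset.mem_range.1 hi)
  rw [Nat.cast_choose ℂ hi, taylorCoeff, taylorCoeff]
  have h (k : ℕ) : (k.factorial : ℂ) ≠ 0 := by exact_mod_cast k.factorial_ne_zero
  field_simp [h]

theorem taylorCoeff_deriv (f : ℂ → ℂ) (n : ℕ) :
    taylorCoeff (deriv f) n = (n + 1) * taylorCoeff f (n + 1) := by
  have h (k : ℕ) : (k.factorial : ℂ) ≠ 0 := by exact_mod_cast k.factorial_ne_zero
  have h' : (n : ℂ) + 1 ≠ 0 := by exact_mod_cast n.succ_ne_zero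
  rw [taylorCoeff, taylorCoeff, iteratedDeriv_succ', Nat.factorial_succ]
  push_cast
  field_simp [h]

theorem taylorCoeff_comp_const_mul (f : ℂ → ℂ) (c : ℂ) (n : ℕ) :
    taylorCoeff (fun z => f (c * z)) n = c ^ n * taylorCoeff f n := by
  have h (n : ℕ) : iteratedDeriv n (fun z => f (c * z)) =
      fun z => c ^ n * iteratedDeriv n f (c * z) := by
    induction n with
    | zero => simp
    | succ n ih =>
      funext z
      rw [iteratedDeriv_succ, ih, deriv_const_mul_field, deriv_comp_mul_left, iteratedDeriv_succ,
        smul_eq_mul]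
      ring
  simp [taylorCoeff, h, mul_div_assoc]

theorem taylorCoeff_eq_of_hasSum {f : ℂ → ℂ} {a : ℕ → ℂ}
    (h : ∀ᶠ z in 𝓝 (0 : ℂ), HasSum (fun n => a n * z ^ n) (f z)) (n : ℕ) :
    taylorCoeff f n = a n := by
  have h1 : HasFPowerSeriesAt f (FormalMultilinearSeries.ofScalars ℂ a) 0 := by
    rw [hasFPowerSeriesAt_iff]
    filter_upwards [h] with z hz
    simpa [mul_comm] using hz
  have h2 := h1.analyticAt.hasFPowerSeriesAt
  have h3 := congrArg (fun p => FormalMultilinearSeries.coeff p n) (h1.eq_formalMultilinearSeries h2)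
  simpa [taylorCoeff] using h3.symm

theorem taylorCoeff_id (n : ℕ) : taylorCoeff (fun z => z) n = if n = 1 then 1 else 0 := by
  refine taylorCoeff_eq_of_hasSum (a := fun n => if n = 1 then 1 else 0) (.of_forall fun z => ?_) n
  convert hasSum_single (f := fun n : ℕ => (if n = 1 then (1 : ℂ) else 0) * z ^ n) 1 ?_ using 1
  · simp
  · intro n hn
    simp [hn]

theorem taylorCoeff_id_mul_succ {f : ℂ → ℂ} (hf : AnalyticAt ℂ f 0) (n : ℕ) :
    taylorCoeff (fun z => z * f z) (n + 1) = taylorCoeff f n := by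
  rw [taylorCoeff_mul (f := fun z => z) analyticAt_id hf, Finset.sum_eq_single 1]
  · simp [taylorCoeff_id]
  · intro i _ hi
    simp [taylorCoeff_id, hi]
  · simp

/-! ### Coefficient bounds for functions bounded by one. -/

theorem analyticAt_zero_of_differentiableOn_ball {f : ℂ → ℂ}
    (hf : DifferentiableOn ℂ f (Metric.ball 0 1)) : AnalyticAt ℂ f 0 :=
  hf.analyticAt (Metric.ball_mem_nhds 0 one_pos)

/-- Cauchy's estimate for functions bounded by one in the unit disk. -/
theorem norm_taylorCoeff_le_one {f : ℂ → ℂ} (hf : DifferentiableOn ℂ f (Metric.ball 0 1))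
    (hb : ∀ z ∈ Metric.ball (0 : ℂ) 1, ‖f z‖ ≤ 1) (n : ℕ) : ‖taylorCoeff f n‖ ≤ 1 := by
  have hn : (0 : ℝ) < n.factorial := by exact_mod_cast n.factorial_pos
  have key : ∀ r ∈ Set.Ioo (0 : ℝ) 1, ‖taylorCoeff f n‖ * r ^ n ≤ 1 := by
    rintro r ⟨h0, h1⟩
    have hsub : Metric.closedBall (0 : ℂ) r ⊆ Metric.ball 0 1 := Metric.closedBall_subset_ball h1
    have := Complex.norm_iteratedDeriv_le_of_forall_mem_sphere_norm_le (c := 0) (C := 1) n h0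
      ((hf.mono (by rwa [closure_ball _ h0.ne'])).diffContOnCl)
      fun z hz => hb z (hsub (Metric.sphere_subset_closedBall hz))
    rw [taylorCoeff, norm_div, Complex.norm_natCast, div_mul_eq_mul_div, div_le_one hn]
    rwa [mul_one, le_div_iff₀ (pow_pos h0 n)] at this
  have hlim : Tendsto (fun r : ℝ => ‖taylorCoeff f n‖ * r ^ n) (𝓝[<] 1) (𝓝 (‖taylorCoeff f n‖)) := by
    have : Continuous fun r : ℝ => ‖taylorCoeff f n‖ * r ^ n := by fun_prop
    simpa using (this.tendsto 1).mono_left nhdsWithin_le_nhds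
  exact le_of_tendsto hlim (by
    filter_upwards [Ioo_mem_nhdsLT (zero_lt_one' ℝ)] with r hr using key r hr)

/-- The difference of the squares is `(1 - |a|²)(1 - |b|²)`. -/
theorem norm_sub_le_norm_one_sub_conj_mul {a b : ℂ} (ha : ‖a‖ ≤ 1) (hb : ‖b‖ ≤ 1) :
    ‖b - a‖ ≤ ‖1 - starRingEnd ℂ a * b‖ := by
  rw [← sq_le_sq₀ (norm_nonneg _) (norm_nonneg _)]
  have ha' : Complex.normSq a ≤ 1 := by
    rw [Complex.normSq_eq_norm_sq]; exact pow_le_one₀ (norm_nonneg _) ha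
  have hb' : Complex.normSq b ≤ 1 := by
    rw [Complex.normSq_eq_norm_sq]; exact pow_le_one₀ (norm_nonneg _) hb
  rw [← Complex.normSq_eq_norm_sq, ← Complex.normSq_eq_norm_sq]
  rw [Complex.normSq_apply] at *
  simp only [Complex.normSq_apply, Complex.sub_re, Complex.sub_im, Complex.mul_re, Complex.mul_im,
    Complex.conj_re, Complex.conj_im, Complex.one_re, Complex.one_im] at *
  nlinarith [mul_nonneg (sub_nonneg.2 ha') (sub_nonneg.2 hb')]

/-- A disk automorphism moves the value at the origin to zero and divides the first nonzero later
coefficient by `1 - |f 0| ^ 2`. -/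
theorem exists_mobius_normalization {f : ℂ → ℂ} (hf : DifferentiableOn ℂ f (Metric.ball 0 1))
    (hb : ∀ z ∈ Metric.ball (0 : ℂ) 1, ‖f z‖ < 1) :
    ∃ m : ℂ → ℂ, DifferentiableOn ℂ m (Metric.ball 0 1) ∧
      (∀ z ∈ Metric.ball (0 : ℂ) 1, ‖m z‖ ≤ 1) ∧
      taylorCoeff f 1 = taylorCoeff m 1 * (1 - ‖f 0‖ ^ 2 : ℝ) ∧
      (taylorCoeff f 1 = 0 → taylorCoeff f 2 = taylorCoeff m 2 * (1 - ‖f 0‖ ^ 2 : ℝ)) := by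
  have h0 : ‖f 0‖ < 1 := hb 0 (by simp)
  have hden : ∀ z ∈ Metric.ball (0 : ℂ) 1, 1 - starRingEnd ℂ (f 0) * f z ≠ 0 := by
    intro z hz h
    have h1 : ‖starRingEnd ℂ (f 0) * f z‖ < 1 := by
      rw [norm_mul, RCLike.norm_conj]
      exact mul_lt_one_of_nonneg_of_lt_one_left (norm_nonneg _) h0 (hb z hz).le
    rw [← sub_eq_zero.1 h] at h1
    simp at h1
  set d : ℂ → ℂ := fun z => 1 - starRingEnd ℂ (f 0) * f z with hd
  have hdd : DifferentiableOn ℂ d (Metric.ball 0 1) := (hf.const_mul _).const_sub _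
  have hm : DifferentiableOn ℂ (fun z => (f z - f 0) / d z) (Metric.ball 0 1) :=
    (hf.sub_const _).div hdd hden
  set m : ℂ → ℂ := fun z => (f z - f 0) / d z with hmdef
  have hfa := analyticAt_zero_of_differentiableOn_ball hf
  have hma := analyticAt_zero_of_differentiableOn_ball hm
  have hda := analyticAt_zero_of_differentiableOn_ball hdd
  have heq (n : ℕ) : taylorCoeff (fun z => f z - f 0) n = taylorCoeff (fun z => m z * d z) n := by
    refine taylorCoeff_congr ?_ n
    filter_upwards [Metric.ball_mem_nhds (0 : ℂ) one_pos] with z hz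
    exact (div_mul_cancel₀ _ (hden z hz)).symm
  have hd0 : d 0 = (1 - ‖f 0‖ ^ 2 : ℝ) := by
    simp only [hd]
    rw [mul_comm, Complex.mul_conj, Complex.normSq_eq_norm_sq]
    push_cast
    rfl
  have hm0 : m 0 = 0 := by simp [hmdef]
  have e1 := heq 1
  have e2 := heq 2
  rw [taylorCoeff_sub hfa analyticAt_const, taylorCoeff_mul hma hda] at e1 e2
  simp only [taylorCoeff_const, Finset.sum_range_succ, Finset.sum_range_zero, taylorCoeff_zero,
    hm0, hd0, Nat.sub_self, Nat.reduceSub, OfNat.ofNat_ne_zero, one_ne_zero, if_false, sub_zero,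
    zero_mul, zero_add] at e1 e2
  refine ⟨m, hm, fun z hz => ?_, e1, fun hf1 => ?_⟩
  · rw [hmdef, norm_div]
    exact div_le_one_of_le₀ (norm_sub_le_norm_one_sub_conj_mul h0.le (hb z hz).le) (norm_nonneg _)
  · have hne : ((1 - ‖f 0‖ ^ 2 : ℝ) : ℂ) ≠ 0 := hd0 ▸ hden 0 (by simp)
    have hm1 : taylorCoeff m 1 = 0 := by
      rw [hf1] at e1
      exact (mul_eq_zero.1 e1.symm).resolve_right hne
    rw [e2, hm1, zero_mul, zero_add]

theorem norm_taylorCoeff_le_of_lt_one {f : ℂ → ℂ} (hf : DifferentiableOn ℂ f (Metric.ball 0 1))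
    (hb : ∀ z ∈ Metric.ball (0 : ℂ) 1, ‖f z‖ < 1) :
    ‖taylorCoeff f 1‖ ≤ 1 - ‖f 0‖ ^ 2 ∧
      (taylorCoeff f 1 = 0 → ‖taylorCoeff f 2‖ ≤ 1 - ‖f 0‖ ^ 2) := by
  obtain ⟨m, hm, hm1, e1, e2⟩ := exists_mobius_normalization hf hb
  have h0 : 0 ≤ 1 - ‖f 0‖ ^ 2 :=
    sub_nonneg.2 (pow_le_one₀ (norm_nonneg _) (hb 0 (by simp)).le)
  refine ⟨?_, fun h => ?_⟩
  · rw [e1, norm_mul, Complex.norm_real, Real.norm_of_nonneg h0]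
    exact mul_le_of_le_one_left h0 (norm_taylorCoeff_le_one hm hm1 1)
  · rw [e2 h, norm_mul, Complex.norm_real, Real.norm_of_nonneg h0]
    exact mul_le_of_le_one_left h0 (norm_taylorCoeff_le_one hm hm1 2)

/-- Apply the strict case to `r f` and let `r → 1`; this also covers unimodular constants, for which
the Möbius denominator vanishes. -/
theorem norm_taylorCoeff_le_of_le_one {f : ℂ → ℂ} (hf : DifferentiableOn ℂ f (Metric.ball 0 1))
    (hb : ∀ z ∈ Metric.ball (0 : ℂ) 1, ‖f z‖ ≤ 1) :
    ‖taylorCoeff f 1‖ ≤ 1 - ‖f 0‖ ^ 2 ∧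
      (taylorCoeff f 1 = 0 → ‖taylorCoeff f 2‖ ≤ 1 - ‖f 0‖ ^ 2) := by
  have key : ∀ r ∈ Set.Ioo (0 : ℝ) 1,
      r * ‖taylorCoeff f 1‖ ≤ 1 - (r * ‖f 0‖) ^ 2 ∧
        (taylorCoeff f 1 = 0 → r * ‖taylorCoeff f 2‖ ≤ 1 - (r * ‖f 0‖) ^ 2) := by
    rintro r ⟨h0, h1⟩
    have hr : ‖(r : ℂ)‖ = r := by rw [Complex.norm_real, Real.norm_of_nonneg h0.le]
    have := norm_taylorCoeff_le_of_lt_one (f := fun z => (r : ℂ) * f z) (hf.const_mul _)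
      fun z hz => by
        rw [norm_mul, hr]
        exact mul_lt_one_of_nonneg_of_lt_one_left h0.le h1 (hb z hz)
    simp only [taylorCoeff_const_mul, norm_mul, hr] at this
    exact ⟨this.1, fun h => this.2 (by rw [h, mul_zero])⟩
  have hev := Ioo_mem_nhdsLT (zero_lt_one' ℝ)
  have hlim (c : ℝ) : Tendsto (fun r : ℝ => r * c) (𝓝[<] 1) (𝓝 c) := by
    have : Continuous fun r : ℝ => r * c := by fun_prop
    simpa using (this.tendsto 1).mono_left nhdsWithin_le_nhds
  have hR : Tendsto (fun r : ℝ => 1 - (r * ‖f 0‖) ^ 2) (𝓝[<] 1) (𝓝 (1 - ‖f 0‖ ^ 2)) :=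
    ((hlim _).pow 2).const_sub 1
  refine ⟨le_of_tendsto_of_tendsto (hlim _) hR ?_, fun h => le_of_tendsto_of_tendsto (hlim _) hR ?_⟩
  · filter_upwards [hev] with r hr using (key r hr).1
  · filter_upwards [hev] with r hr using (key r hr).2 h

/-- The coefficients `c₁`, `c₂` of a function bounded by one are at most `1 - |c₀| ^ 2`. -/
theorem norm_taylorCoeff_two_le {f : ℂ → ℂ} (hf : DifferentiableOn ℂ f (Metric.ball 0 1))
    (hb : ∀ z ∈ Metric.ball (0 : ℂ) 1, ‖f z‖ ≤ 1) :
    ‖taylorCoeff f 2‖ ≤ 1 - ‖f 0‖ ^ 2 := by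
  have hmaps : Set.MapsTo (fun z : ℂ => -1 * z) (Metric.ball 0 1) (Metric.ball 0 1) := by
    intro z hz; simpa using hz
  have hneg : DifferentiableOn ℂ (fun z => f (-1 * z)) (Metric.ball 0 1) :=
    hf.comp (by fun_prop) hmaps
  -- The even part of `f` keeps `c₀` and `c₂` and has `c₁ = 0`, the case settled by the Möbius
  -- normalization.
  have hc (n : ℕ) : taylorCoeff (fun z => 1 / 2 * (f z + f (-1 * z))) n =
      1 / 2 * (taylorCoeff f n + (-1) ^ n * taylorCoeff f n) := by
    rw [taylorCoeff_const_mul, taylorCoeff_add (analyticAt_zero_of_differentiableOn_ball hf)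
      (analyticAt_zero_of_differentiableOn_ball hneg), taylorCoeff_comp_const_mul]
  have := (norm_taylorCoeff_le_of_le_one (f := fun z => 1 / 2 * (f z + f (-1 * z)))
    ((hf.add hneg).const_mul _) fun z hz => by
      rw [norm_mul]
      have h1 := norm_add_le (f z) (f (-1 * z))
      have h2 := hb z hz
      have h3 := hb _ (hmaps hz)
      norm_num at h1 h3 ⊢
      linarith).2 (by rw [hc]; ring)
  rw [hc] at this
  convert this using 2
  · ring
  · simp only [mul_zero]
    ring_nf

/-- The **Schwarz lemma** in terms of `dslope`. -/
theorem norm_dslope_le_one {f : ℂ → ℂ} (hf : DifferentiableOn ℂ f (Metric.ball 0 1))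
    (hb : ∀ z ∈ Metric.ball (0 : ℂ) 1, ‖f z‖ ≤ 1) (h0 : f 0 = 0) :
    ∀ z ∈ Metric.ball (0 : ℂ) 1, ‖dslope f 0 z‖ ≤ 1 := by
  intro z hz
  have := Complex.norm_dslope_le_div_of_mapsTo_ball (R₂ := 1) hf
    (fun w hw => by simpa [h0] using hb w hw) hz
  simpa using this

theorem differentiableOn_dslope_ball {f : ℂ → ℂ} (hf : DifferentiableOn ℂ f (Metric.ball 0 1)) :
    DifferentiableOn ℂ (dslope f 0) (Metric.ball 0 1) :=
  (Complex.differentiableOn_dslope (Metric.ball_mem_nhds 0 one_pos)).2 hf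

theorem taylorCoeff_dslope {f : ℂ → ℂ} (hf : DifferentiableOn ℂ f (Metric.ball 0 1))
    (h0 : f 0 = 0) (n : ℕ) : taylorCoeff (dslope f 0) n = taylorCoeff f (n + 1) := by
  rw [← taylorCoeff_id_mul_succ
    (analyticAt_zero_of_differentiableOn_ball (differentiableOn_dslope_ball hf))]
  congr 1
  funext z
  simpa [h0] using sub_smul_dslope f 0 z

/-! ### Boundary behaviour and Jack's lemma. -/

/-- Boundary form of the Schwarz lemma: the derivative at a boundary fixed point is real and at
least one. -/
theorem exists_one_le_deriv_eq_of_boundary_fixed {h : ℂ → ℂ} {k : ℂ} (hk : HasDerivAt h k 1)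
    (hb : ∀ z : ℂ, ‖z‖ < 1 → ‖h z‖ ≤ ‖z‖) (h1 : h 1 = 1) : ∃ t : ℝ, 1 ≤ t ∧ k = t := by
  have key : ∀ v : ℂ, v.re < 0 → (k * v).re ≤ v.re := by
    intro v hv
    have hline : HasDerivAt (fun t : ℝ => (1 : ℂ) + t * v) v 0 := by
      simpa using ((Complex.ofRealCLM.hasDerivAt (x := (0 : ℝ))).mul_const v).const_add 1
    have hcomp : HasDerivAt (fun t : ℝ => h (1 + t * v)) (k * v) 0 := by
      have hk' : HasDerivAt h k (1 + ((0 : ℝ) : ℂ) * v) := by simpa using hk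
      exact hk'.comp (0 : ℝ) hline
    have hre : HasDerivAt (fun t : ℝ => (h (1 + t * v)).re) (k * v).re 0 :=
      Complex.reCLM.hasFDerivAt.comp_hasDerivAt (0 : ℝ) hcomp
    -- The function is `1 + |1 + tv|² - 2 Re h(1 + tv)`. It vanishes at `t = 0` and is nonnegative
    -- for small `t > 0`, because `2 Re h ≤ 1 + |h|² ≤ 1 + |1 + tv|²`; so its derivative at `0` is
    -- nonnegative.
    have hF : HasDerivAt (fun t : ℝ => 2 + 2 * v.re * t + Complex.normSq v * t ^ 2 -
        2 * (h (1 + t * v)).re) (2 * v.re - 2 * (k * v).re) 0 := by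
      have hp : HasDerivAt (fun t : ℝ => 2 + 2 * v.re * t + Complex.normSq v * t ^ 2)
          (2 * v.re) 0 := by
        have h1 := (((hasDerivAt_id (0 : ℝ)).const_mul (2 * v.re)).const_add 2).add
          (((hasDerivAt_id (0 : ℝ)).pow 2).const_mul (Complex.normSq v))
        refine h1.congr_deriv ?_
        simp
      exact hp.sub (hre.const_mul 2)
    have hlim := hF.tendsto_slope_zero_right
    have hv0 : 0 < Complex.normSq v := Complex.normSq_pos.2 (by rintro rfl; simp at hv)
    have : 0 ≤ 2 * v.re - 2 * (k * v).re := by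
      refine ge_of_tendsto hlim ?_
      have hpos : 0 < -2 * v.re / Complex.normSq v := div_pos (by linarith) hv0
      filter_upwards [Ioo_mem_nhdsGT hpos] with t ht
      have ht2 : Complex.normSq v * t < -2 * v.re := by
        rw [mul_comm]; exact (lt_div_iff₀ hv0).1 ht.2
      have hsq : ‖(1 : ℂ) + t * v‖ ^ 2 = 1 + 2 * v.re * t + Complex.normSq v * t ^ 2 := by
        rw [← Complex.normSq_eq_norm_sq, Complex.normSq_apply, Complex.normSq_apply]
        simp
        ring
      have hlt : ‖(1 : ℂ) + t * v‖ < 1 := by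
        rw [← sq_lt_one_iff₀ (norm_nonneg _), hsq]
        nlinarith [ht.1]
      have hle := hb _ hlt
      have hre_le := Complex.re_le_norm (h (1 + t * v))
      have : 0 ≤ 2 + 2 * v.re * t + Complex.normSq v * t ^ 2 - 2 * (h (1 + t * v)).re := by
        nlinarith [sq_nonneg (‖h (1 + t * v)‖ - 1),
          pow_le_pow_left₀ (norm_nonneg (h (1 + t * v))) hle 2]
      have ht0 := ht.1
      simpa [h1] using mul_nonneg (inv_nonneg.2 ht0.le) this
    linarith
  have hre : 1 ≤ k.re := by
    have := key (-1) (by simp)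
    simp at this
    linarith
  -- Directions `-e - is` tending to the imaginary axis give `s · Im k ≤ e (Re k - 1) → 0` for both
  -- signs of `s`.
  have him : k.im = 0 := by
    have hle (s : ℝ) : s * k.im ≤ 0 := by
      have hlim : Tendsto (fun e : ℝ => e * (k.re - 1)) (𝓝[>] 0) (𝓝 0) := by
        have : Continuous fun e : ℝ => e * (k.re - 1) := by fun_prop
        simpa using (this.tendsto 0).mono_left nhdsWithin_le_nhds
      refine ge_of_tendsto hlim ?_
      filter_upwards [self_mem_nhdsWithin] with e he
      have he : 0 < e := he
      have := key ⟨-e, -s⟩ (by simpa using he)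
      simp at this
      linarith
    have h1 := hle 1
    have h2 := hle (-1)
    linarith
  exact ⟨k.re, hre, Complex.ext rfl (by simpa using him)⟩

/-- **Jack's lemma**. -/
theorem exists_boundary_point_of_not_forall_norm_lt_one {w : ℂ → ℂ}
    (hw : DifferentiableOn ℂ w (Metric.ball 0 1)) (h0 : w 0 = 0)
    (hnot : ¬ ∀ z ∈ Metric.ball (0 : ℂ) 1, ‖w z‖ < 1) :
    ∃ z ∈ Metric.ball (0 : ℂ) 1, z ≠ 0 ∧ ‖w z‖ = 1 ∧
      ∃ t : ℝ, 1 ≤ t ∧ z * deriv w z = t * w z := by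
  push Not at hnot
  obtain ⟨z₁, hz₁, hwz₁⟩ := hnot
  have hz₁' : ‖z₁‖ < 1 := by simpa using hz₁
  have hsub : Metric.closedBall (0 : ℂ) ‖z₁‖ ⊆ Metric.ball 0 1 :=
    Metric.closedBall_subset_ball hz₁'
  have hcont : ContinuousOn (fun z => ‖w z‖) (Metric.closedBall 0 ‖z₁‖) :=
    (hw.continuousOn.mono hsub).norm
  have hcomp : IsCompact (Metric.closedBall (0 : ℂ) ‖z₁‖ ∩ (fun z => ‖w z‖) ⁻¹' Set.Ici 1) :=
    (isCompact_closedBall 0 ‖z₁‖).of_isClosed_subset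
      (hcont.preimage_isClosed_of_isClosed Metric.isClosed_closedBall isClosed_Ici)
      Set.inter_subset_left
  -- A point of least modulus with `|w| ≥ 1`: on the smaller open disk `|w| < 1`, so `z ↦ w (z₀ z) /
  -- w z₀` is a Schwarz function fixing `1`.
  obtain ⟨z₀, ⟨hz₀, hwz₀⟩, hmin⟩ := hcomp.exists_isMinOn
    ⟨z₁, by simp, hwz₁⟩ (f := fun z : ℂ => ‖z‖) continuous_norm.continuousOn
  have hwz₀ : 1 ≤ ‖w z₀‖ := hwz₀
  have hz₀b := hsub hz₀
  have hz₀le : ‖z₀‖ ≤ ‖z₁‖ := by simpa using hz₀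
  have hz₀n : z₀ ≠ 0 := by
    rintro rfl
    rw [h0, norm_zero] at hwz₀
    linarith
  have hlt : ∀ z : ℂ, ‖z‖ < ‖z₀‖ → ‖w z‖ < 1 := by
    intro z hz
    by_contra hge
    have : ‖z₀‖ ≤ ‖z‖ := hmin ⟨by simpa using hz.le.trans hz₀le, not_lt.1 hge⟩
    linarith
  have hdz₀ : DifferentiableAt ℂ w z₀ := hw.differentiableAt (Metric.isOpen_ball.mem_nhds hz₀b)
  have hmul : ∀ z : ℂ, ‖z‖ < 1 → ‖z₀ * z‖ < ‖z₀‖ := by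
    intro z hz
    rw [norm_mul]
    exact mul_lt_of_lt_one_right (norm_pos_iff.2 hz₀n) hz
  have hone : ‖w z₀‖ = 1 := by
    refine le_antisymm ?_ hwz₀
    have hlim : Tendsto (fun t : ℝ => ‖w (z₀ * t)‖) (𝓝[<] 1) (𝓝 ‖w z₀‖) := by
      have hc : ContinuousAt (fun t : ℝ => ‖w (z₀ * t)‖) 1 := by
        refine ContinuousAt.norm (ContinuousAt.comp ?_ (by fun_prop))
        simpa using hdz₀.continuousAt
      simpa using hc.tendsto.mono_left nhdsWithin_le_nhds
    refine le_of_tendsto hlim ?_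
    filter_upwards [Ioo_mem_nhdsLT (zero_lt_one' ℝ)] with t ht
    exact (hlt _ (hmul t (by rw [Complex.norm_real, Real.norm_of_nonneg ht.1.le]; exact ht.2))).le
  have hwne : w z₀ ≠ 0 := norm_ne_zero_iff.1 (by rw [hone]; exact one_ne_zero)
  have hder : HasDerivAt (fun z => w (z₀ * z) / w z₀) (deriv w z₀ * z₀ / w z₀) 1 := by
    have h1 : HasDerivAt w (deriv w z₀) (z₀ * 1) := by simpa using hdz₀.hasDerivAt
    have h2 : HasDerivAt (fun z : ℂ => z₀ * z) z₀ 1 := by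
      simpa using (hasDerivAt_id (1 : ℂ)).const_mul z₀
    exact (h1.comp (1 : ℂ) h2).div_const _
  have hdiff : DifferentiableOn ℂ (fun z => w (z₀ * z) / w z₀) (Metric.ball 0 1) := by
    refine (hw.comp (by fun_prop) fun z hz => ?_).div_const _
    have hz : ‖z‖ < 1 := by simpa using hz
    simpa [-norm_mul] using (hmul z hz).trans_le (hz₀le.trans hz₁'.le)
  obtain ⟨t, ht, hteq⟩ := exists_one_le_deriv_eq_of_boundary_fixed hder
    (fun z hz => Complex.norm_le_norm_of_mapsTo_ball hdiff
      (fun z hz => by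
        have hz : ‖z‖ < 1 := by simpa using hz
        simpa [hone] using (hlt _ (hmul z hz)).le) (by simp [h0]) hz)
    (by simp [hwne])
  refine ⟨z₀, hz₀b, hz₀n, hone, t, ht, ?_⟩
  rw [← hteq]
  field_simp

/-! ### Square roots and subordination to `(1 + z)²`. -/

/-- A nowhere vanishing holomorphic function on the unit disk has a holomorphic square root. -/
theorem exists_differentiableOn_sq_eq {p : ℂ → ℂ} (hp : DifferentiableOn ℂ p (Metric.ball 0 1))
    (h0 : p 0 = 1) (hne : ∀ z ∈ Metric.ball (0 : ℂ) 1, p z ≠ 0) :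
    ∃ q : ℂ → ℂ, DifferentiableOn ℂ q (Metric.ball 0 1) ∧ q 0 = 1 ∧
      ∀ z ∈ Metric.ball (0 : ℂ) 1, p z = q z ^ 2 := by
  have hdp : DifferentiableOn ℂ (fun z => deriv p z / p z) (Metric.ball 0 1) :=
    (hp.deriv Metric.isOpen_ball).div hp hne
  -- A primitive of `p' / p` is a logarithm of `p` up to a constant; half of it exponentiates to the
  -- root.
  obtain ⟨L, hL⟩ := hdp.isExactOn_ball
  have hconst : ∀ z ∈ Metric.ball (0 : ℂ) 1,
      p z * Complex.exp (-(L z - L 0)) = p 0 * Complex.exp (-(L 0 - L 0)) := by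
    intro z hz
    refine (convex_ball (0 : ℂ) 1).is_const_of_fderivWithin_eq_zero (𝕜 := ℂ)
      (f := fun z => p z * Complex.exp (-(L z - L 0))) ?_ ?_ hz (by simp)
    · intro x hx
      exact ((hp.differentiableAt (Metric.isOpen_ball.mem_nhds hx)).mul
        (((hL x hx).differentiableAt.sub_const _).neg.cexp)).differentiableWithinAt
    · intro x hx
      have h1 := (hp.differentiableAt (Metric.isOpen_ball.mem_nhds hx)).hasDerivAt
      have h2 := h1.mul (((hL x hx).sub_const (L 0)).neg.cexp)
      have h3 := h2.hasFDerivAt.hasFDerivWithinAt (s := Metric.ball (0 : ℂ) 1)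
      have h4 := h3.fderivWithin (Metric.isOpen_ball.uniqueDiffWithinAt hx)
      refine h4.trans ?_
      ext
      have := hne x hx
      simp
      field_simp
      ring
  refine ⟨fun z => Complex.exp ((L z - L 0) / 2), ?_, by simp, fun z hz => ?_⟩
  · intro x hx
    exact (((hL x hx).differentiableAt.sub_const _).div_const 2).cexp.differentiableWithinAt
  · have := hconst z hz
    rw [h0, sub_self, neg_zero, Complex.exp_zero, mul_one, Complex.exp_neg] at this
    rw [← Complex.exp_nat_mul]
    have he := Complex.exp_ne_zero (L z - L 0)
    field_simp at this
    rw [this]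
    congr 1
    push_cast
    ring

/-- If `|p - z p' - 1| < 1` then `p` is subordinate to `(1 + z) ^ 2`. -/
theorem exists_eq_one_add_sq {p : ℂ → ℂ} (hp : DifferentiableOn ℂ p (Metric.ball 0 1))
    (h0 : p 0 = 1) (hne : ∀ z ∈ Metric.ball (0 : ℂ) 1, p z ≠ 0)
    (hb : ∀ z ∈ Metric.ball (0 : ℂ) 1, ‖p z - z * deriv p z - 1‖ < 1) :
    ∃ w : ℂ → ℂ, DifferentiableOn ℂ w (Metric.ball 0 1) ∧ w 0 = 0 ∧
      (∀ z ∈ Metric.ball (0 : ℂ) 1, ‖w z‖ < 1) ∧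
      ∀ z ∈ Metric.ball (0 : ℂ) 1, p z = (1 + w z) * (1 + w z) := by
  obtain ⟨q, hq, hq0, hpq⟩ := exists_differentiableOn_sq_eq hp h0 hne
  have hw : DifferentiableOn ℂ (fun z => q z - 1) (Metric.ball 0 1) := hq.sub_const 1
  have hpw : ∀ z ∈ Metric.ball (0 : ℂ) 1, p z = (1 + (q z - 1)) * (1 + (q z - 1)) := by
    intro z hz
    rw [hpq z hz]
    ring
  refine ⟨fun z => q z - 1, hw, by simp [hq0], ?_, hpw⟩
  by_contra hnot
  obtain ⟨z, hz, -, hnorm, t, ht, heq⟩ :=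
    exists_boundary_point_of_not_forall_norm_lt_one hw (by simp [hq0]) hnot
  have hqd := (hq.differentiableAt (Metric.isOpen_ball.mem_nhds hz)).hasDerivAt
  have hdp : deriv p z = 2 * q z * deriv q z := by
    have : p =ᶠ[𝓝 z] fun z => q z ^ 2 := by
      filter_upwards [Metric.isOpen_ball.mem_nhds hz] with x hx using hpq x hx
    rw [this.deriv_eq, (hqd.fun_pow 2).deriv]
    norm_num
  rw [deriv_sub_const] at heq
  have hE := hb z hz
  -- With `w = q - 1`, `|w| = 1` and `z w' = t w`, the second factor has modulus at least `(2t - 1)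
  -- - 2(t - 1) = 1`, against the strict bound.
  have hfac : p z - z * deriv p z - 1 =
      (q z - 1) * (((2 * (1 - t) : ℝ) : ℂ) - ((2 * t - 1 : ℝ) : ℂ) * (q z - 1)) := by
    rw [hdp, hpq z hz]
    push_cast
    linear_combination (-2 * q z) * heq
  rw [hfac, norm_mul, hnorm, one_mul, norm_sub_rev] at hE
  have h1 := norm_sub_norm_le (((2 * t - 1 : ℝ) : ℂ) * (q z - 1)) ((2 * (1 - t) : ℝ) : ℂ)
  rw [norm_mul, hnorm, mul_one, Complex.norm_real, Complex.norm_real,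
    Real.norm_of_nonneg (by linarith), Real.norm_of_nonpos (by linarith)] at h1
  linarith

/-! ### The coefficient inequalities for the class. -/

/-- Here `g` is `f / z` with its singularity removed and `p = 1 / g`; the defining expression of the
class becomes `p - z p' - 1`. -/
theorem ClassU.exists_reciprocal {f : ℂ → ℂ} (hf : ClassU f) :
    ∃ g p : ℂ → ℂ, DifferentiableOn ℂ g (Metric.ball 0 1) ∧
      DifferentiableOn ℂ p (Metric.ball 0 1) ∧ p 0 = 1 ∧
      (∀ z ∈ Metric.ball (0 : ℂ) 1, p z ≠ 0) ∧
      (∀ z ∈ Metric.ball (0 : ℂ) 1, ‖p z - z * deriv p z - 1‖ < 1) ∧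
      (∀ z ∈ Metric.ball (0 : ℂ) 1, g z * p z = 1) ∧
      ∀ n, taylorCoeff g n = taylorCoeff f (n + 1) := by
  have hfd : DifferentiableOn ℂ f (Metric.ball 0 1) := hf.analytic.differentiableOn
  have hg := differentiableOn_dslope_ball hfd
  have hg0 : dslope f 0 0 = 1 := by rw [dslope_same, hf.deriv_zero]
  have hfg : ∀ z, f z = z * dslope f 0 z := fun z => by
    simpa [hf.map_zero] using (sub_smul_dslope f 0 z).symm
  have hgne : ∀ z ∈ Metric.ball (0 : ℂ) 1, dslope f 0 z ≠ 0 := by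
    intro z hz h
    rcases eq_or_ne z 0 with rfl | hz0
    · rw [hg0] at h
      exact one_ne_zero h
    · exact hf.ne_zero z hz hz0 (by rw [hfg, h, mul_zero])
  refine ⟨dslope f 0, fun z => (dslope f 0 z)⁻¹, hg, hg.inv hgne, by simp [hf.deriv_zero],
    fun z hz => inv_ne_zero (hgne z hz), fun z hz => ?_, fun z hz => mul_inv_cancel₀ (hgne z hz),
    taylorCoeff_dslope hfd hf.map_zero⟩
  rcases eq_or_ne z 0 with rfl | hz0
  · simp only [hg0]
    simp
  · have hlt := hf.norm_lt z hz hz0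
    have hgz := hgne z hz
    have hgd := (hg.differentiableAt (Metric.isOpen_ball.mem_nhds hz)).hasDerivAt
    have hdf : deriv f z = dslope f 0 z + z * deriv (dslope f 0) z := by
      have h1 := (hasDerivAt_id z).fun_mul hgd
      have h2 : f = fun y => id y * dslope f 0 y := funext hfg
      conv_lhs => rw [h2]
      rw [h1.deriv]
      simp
    rw [(hgd.fun_inv hgz).deriv]
    rw [hdf, hfg z] at hlt
    convert hlt using 2
    field_simp
    ring

theorem ClassU.norm_taylorCoeff_le {f : ℂ → ℂ} (hf : ClassU f) :
    ‖taylorCoeff f 2 * taylorCoeff f 3 - taylorCoeff f 4‖ ≤ 2 ∧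
      ‖taylorCoeff f 2 * taylorCoeff f 4 - taylorCoeff f 5‖ ≤ 3 := by
  obtain ⟨g, p, hg, hp, hp0, hpne, hE, hgp, hgf⟩ := hf.exists_reciprocal
  have hga := analyticAt_zero_of_differentiableOn_ball hg
  have hpa := analyticAt_zero_of_differentiableOn_ball hp
  have hf1 : taylorCoeff f 1 = 1 := by rw [taylorCoeff_one, hf.deriv_zero]
  have hball := Metric.ball_mem_nhds (0 : ℂ) one_pos
  -- the coefficients of `f` in terms of those of `p = z / f`
  have hrec (n : ℕ) := (taylorCoeff_mul hga hpa n).symm.trans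
    ((taylorCoeff_congr (g := fun _ => 1) (by filter_upwards [hball] with z hz using hgp z hz)
      n).trans (taylorCoeff_const 1 n))
  have r1 := hrec 1
  have r2 := hrec 2
  have r3 := hrec 3
  have r4 := hrec 4
  simp only [Finset.sum_range_succ, Finset.sum_range_zero, hgf, taylorCoeff_zero, hp0, hf1,
    Nat.sub_self, Nat.reduceSub, Nat.sub_zero, Nat.reduceAdd, OfNat.ofNat_ne_zero, one_ne_zero,
    if_false, zero_add, one_mul, mul_one] at r1 r2 r3 r4
  -- bounds on the coefficients of `p`
  obtain ⟨w, hw, hw0, hwlt, hpw⟩ := exists_eq_one_add_sq hp hp0 hpne hE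
  have hwle : ∀ z ∈ Metric.ball (0 : ℂ) 1, ‖w z‖ ≤ 1 := fun z hz => (hwlt z hz).le
  have hψ := norm_dslope_le_one hw hwle hw0
  have hψ0 := norm_taylorCoeff_le_one (differentiableOn_dslope_ball hw) hψ 0
  have hψ1 := (norm_taylorCoeff_le_of_le_one (differentiableOn_dslope_ball hw) hψ).1
  rw [← taylorCoeff_zero (dslope w 0), taylorCoeff_dslope hw hw0, taylorCoeff_dslope hw hw0] at hψ1
  rw [taylorCoeff_dslope hw hw0] at hψ0
  have hwa := analyticAt_zero_of_differentiableOn_ball hw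
  have h1w : AnalyticAt ℂ (fun z => 1 + w z) 0 := analyticAt_const.add hwa
  have hpc (n : ℕ) := (taylorCoeff_congr (f := p) (g := fun z => (1 + w z) * (1 + w z))
    (by filter_upwards [hball] with z hz using hpw z hz) n).trans (taylorCoeff_mul h1w h1w n)
  have b1 := hpc 1
  have b2 := hpc 2
  simp only [Finset.sum_range_succ, Finset.sum_range_zero, taylorCoeff_add analyticAt_const hwa,
    taylorCoeff_const, taylorCoeff_zero, hw0, Nat.sub_self, Nat.reduceSub, Nat.sub_zero,
    OfNat.ofNat_ne_zero, one_ne_zero, if_false, if_true, zero_add, add_zero, one_mul,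
    mul_one] at b1 b2
  -- bounds from the defining inequality
  set E : ℂ → ℂ := fun z => p z - z * deriv p z - 1 with hEdef
  have hdp : DifferentiableOn ℂ (deriv p) (Metric.ball 0 1) := hp.deriv Metric.isOpen_ball
  have hEd : DifferentiableOn ℂ E (Metric.ball 0 1) :=
    (hp.sub (differentiableOn_id.mul hdp)).sub_const 1
  have hE0 : E 0 = 0 := by simp [hEdef, hp0]
  have hEc (n : ℕ) : taylorCoeff E (n + 1) = -n * taylorCoeff p (n + 1) := by
    have hzp : AnalyticAt ℂ (fun z => z * deriv p z) 0 := analyticAt_id.mul hpa.deriv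
    rw [hEdef, taylorCoeff_sub (f := fun z => p z - z * deriv p z) (hpa.sub hzp) analyticAt_const,
      taylorCoeff_sub hpa hzp,
      taylorCoeff_id_mul_succ hpa.deriv, taylorCoeff_deriv, taylorCoeff_const]
    simp
    ring
  have hd1 := differentiableOn_dslope_ball hEd
  -- `p₁` cancels in `p - z p'`, so `E` can be divided by `z` twice.
  have hd10 : dslope E 0 0 = 0 := by
    rw [← taylorCoeff_zero (dslope E 0), taylorCoeff_dslope hEd hE0, hEc]
    simp
  have hd2 := differentiableOn_dslope_ball hd1
  have hφ := norm_dslope_le_one hd1 (norm_dslope_le_one hEd (fun z hz => (hE z hz).le) hE0) hd10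
  have hφc (n : ℕ) : taylorCoeff (dslope (dslope E 0) 0) n =
      -(n + 1) * taylorCoeff p (n + 2) := by
    rw [taylorCoeff_dslope hd1 hd10, taylorCoeff_dslope hEd hE0, hEc]
    push_cast
    rfl
  have c0 := norm_taylorCoeff_le_one hd2 hφ 0
  have c1 := (norm_taylorCoeff_le_of_le_one hd2 hφ).1
  have c2 := norm_taylorCoeff_two_le hd2 hφ
  rw [← taylorCoeff_zero (dslope (dslope E 0) 0)] at c1 c2
  simp only [hφc, norm_mul, norm_neg] at c0 c1 c2
  norm_num at c0 c1 c2
  have ha2 : ‖taylorCoeff f 2‖ ≤ 2 := by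
    rw [show taylorCoeff f 2 = -(2 * taylorCoeff w 1) by linear_combination r1 - b1, norm_neg,
      norm_mul]
    norm_num at hψ0 ⊢
    linarith
  -- `|w₂| ≤ 1 - |w₁|²` gives `|a₃| ≤ 3|w₁|² + 2(1 - |w₁|²) = 2 + |w₁|²`.
  have ha3 : ‖taylorCoeff f 3‖ ≤ 3 := by
    have h := norm_sub_le (3 * taylorCoeff w 1 ^ 2) (2 * taylorCoeff w 2)
    rw [show taylorCoeff f 3 = 3 * taylorCoeff w 1 ^ 2 - 2 * taylorCoeff w 2 by
      linear_combination r2 - b2 - taylorCoeff p 1 * r1 +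
        (taylorCoeff p 1 + 2 * taylorCoeff w 1) * b1]
    norm_num at h hψ0 hψ1
    nlinarith [norm_nonneg (taylorCoeff w 1)]
  have x0 := norm_nonneg (taylorCoeff p 2)
  constructor
  · rw [show taylorCoeff f 2 * taylorCoeff f 3 - taylorCoeff f 4 =
      taylorCoeff p 2 * taylorCoeff f 2 + taylorCoeff p 3 by
        linear_combination taylorCoeff f 3 * r1 - r3]
    refine (norm_add_le _ _).trans ?_
    rw [norm_mul]
    -- With `x = |p₂| ≤ 1` the bound is `2x + (1 - x²)/2`, increasing on `[0, 1]` with value `2` at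
    -- `x = 1`.
    nlinarith [mul_le_mul_of_nonneg_left ha2 x0]
  · rw [show taylorCoeff f 2 * taylorCoeff f 4 - taylorCoeff f 5 =
      taylorCoeff p 2 * taylorCoeff f 3 + taylorCoeff p 3 * taylorCoeff f 2 + taylorCoeff p 4 by
        linear_combination taylorCoeff f 4 * r1 - r4]
    refine (norm_add₃_le).trans ?_
    rw [norm_mul, norm_mul]
    -- The bound is `3x + (1 - x²) + (1 - x²)/3`, increasing on `[0, 1]` with value `3` at `x = 1`.
    nlinarith [mul_le_mul_of_nonneg_left ha3 x0,
      mul_le_mul_of_nonneg_left ha2 (norm_nonneg (taylorCoeff p 3))]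

/-! ### Sharpness: the Koebe function and its rotations. -/

theorem hasSum_koebe {z : ℂ} (hz : z ∈ Metric.ball (0 : ℂ) 1) :
    HasSum (fun n : ℕ => (n : ℂ) * z ^ n) (koebe z) :=
  hasSum_coe_mul_geometric_of_norm_lt_one (by simpa using hz)

theorem taylorCoeff_koebe (n : ℕ) : taylorCoeff koebe n = n :=
  taylorCoeff_eq_of_hasSum (a := fun n => (n : ℂ)) (by
    filter_upwards [Metric.ball_mem_nhds (0 : ℂ) one_pos] with z hz using hasSum_koebe hz) n

theorem one_sub_ne_zero_of_mem_ball {z : ℂ} (hz : z ∈ Metric.ball (0 : ℂ) 1) : 1 - z ≠ 0 := by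
  intro h
  rw [← sub_eq_zero.1 h] at hz
  simp at hz

theorem hasDerivAt_koebe {z : ℂ} (hz : 1 - z ≠ 0) :
    HasDerivAt koebe ((1 + z) / (1 - z) ^ 3) z := by
  have h := (hasDerivAt_id z).fun_div (((hasDerivAt_id z).const_sub 1).fun_pow 2)
    (pow_ne_zero 2 hz)
  refine h.congr_deriv ?_
  simp only [id]
  push_cast
  field_simp
  ring

theorem classU_koebe : ClassU koebe where
  analytic := by
    refine DifferentiableOn.analyticOnNhd (fun z hz => ?_) Metric.isOpen_ball
    exact (hasDerivAt_koebe
      (one_sub_ne_zero_of_mem_ball hz)).differentiableAt.differentiableWithinAt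
  map_zero := by simp [koebe]
  deriv_zero := by simpa using (hasDerivAt_koebe (z := 0) (by simp)).deriv
  ne_zero z hz hz0 := div_ne_zero hz0 (pow_ne_zero 2 (one_sub_ne_zero_of_mem_ball hz))
  norm_lt z hz hz0 := by
    have h := one_sub_ne_zero_of_mem_ball hz
    rw [(hasDerivAt_koebe h).deriv, koebe]
    have : (z / (z / (1 - z) ^ 2)) ^ 2 * ((1 + z) / (1 - z) ^ 3) - 1 = -z ^ 2 := by
      field_simp
      ring
    rw [this, norm_neg, norm_pow]
    exact pow_lt_one₀ (norm_nonneg _) (by simpa using hz) two_ne_zero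

theorem deriv_diskRotation (θ : ℝ) (f : ℂ → ℂ) (z : ℂ) :
    deriv (diskRotation θ f) z = deriv f (Complex.exp (θ * Complex.I) * z) := by
  have h : diskRotation θ f = fun z =>
      Complex.exp (-(θ * Complex.I)) * f (Complex.exp (θ * Complex.I) * z) := rfl
  rw [h, deriv_const_mul_field, deriv_comp_mul_left, smul_eq_mul, ← mul_assoc, ← Complex.exp_add]
  simp

theorem ClassU.diskRotation {f : ℂ → ℂ} (hf : ClassU f) (θ : ℝ) : ClassU (diskRotation θ f) := by
  have hmaps : Set.MapsTo (fun z => Complex.exp (θ * Complex.I) * z) (Metric.ball 0 1)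
      (Metric.ball 0 1) := by
    intro z hz
    simpa [Complex.norm_exp_ofReal_mul_I] using hz
  have hne := Complex.exp_ne_zero (θ * Complex.I)
  refine ⟨⟨?_, ?_, ?_⟩, ?_, ?_⟩
  · refine DifferentiableOn.analyticOnNhd ?_ Metric.isOpen_ball
    exact (hf.analytic.differentiableOn.comp (by fun_prop) hmaps).const_mul _
  · simp [_root_.diskRotation, hf.map_zero]
  · simp [deriv_diskRotation, hf.deriv_zero]
  · intro z hz hz0
    exact mul_ne_zero (Complex.exp_ne_zero _) (hf.ne_zero _ (hmaps hz) (mul_ne_zero hne hz0))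
  · intro z hz hz0
    have h := hf.norm_lt _ (hmaps hz) (mul_ne_zero hne hz0)
    rw [deriv_diskRotation, _root_.diskRotation, Complex.exp_neg, ← div_div, div_inv_eq_mul,
      mul_comm z]
    exact h

theorem taylorCoeff_diskRotation (θ : ℝ) (f : ℂ → ℂ) (n : ℕ) :
    taylorCoeff (diskRotation θ f) (n + 1) =
      Complex.exp (θ * Complex.I) ^ n * taylorCoeff f (n + 1) := by
  have h : diskRotation θ f = fun z =>
      Complex.exp (-(θ * Complex.I)) * f (Complex.exp (θ * Complex.I) * z) := rfl
  rw [h, taylorCoeff_const_mul, taylorCoeff_comp_const_mul, Complex.exp_neg, pow_succ]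
  field_simp [Complex.exp_ne_zero]

/-- Rotation multiplies `aₙ₊₁` by `uⁿ` with `|u| = 1`, and the two functionals are homogeneous of
weights 3 and 4. -/
theorem norm_taylorCoeff_diskRotation (θ : ℝ) (f : ℂ → ℂ) :
    ‖taylorCoeff (diskRotation θ f) 2 * taylorCoeff (diskRotation θ f) 3
        - taylorCoeff (diskRotation θ f) 4‖ =
      ‖taylorCoeff f 2 * taylorCoeff f 3 - taylorCoeff f 4‖ ∧
    ‖taylorCoeff (diskRotation θ f) 2 * taylorCoeff (diskRotation θ f) 4
        - taylorCoeff (diskRotation θ f) 5‖ =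
      ‖taylorCoeff f 2 * taylorCoeff f 4 - taylorCoeff f 5‖ := by
  set u := Complex.exp (θ * Complex.I) with hu
  have hnu : ‖u‖ = 1 := Complex.norm_exp_ofReal_mul_I θ
  have h (n : ℕ) := taylorCoeff_diskRotation θ f n
  rw [h 1, h 2, h 3, h 4, ← hu]
  constructor
  · rw [show u ^ 1 * taylorCoeff f (1 + 1) * (u ^ 2 * taylorCoeff f (2 + 1)) -
      u ^ 3 * taylorCoeff f (3 + 1) =
        u ^ 3 * (taylorCoeff f 2 * taylorCoeff f 3 - taylorCoeff f 4) by ring]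
    rw [norm_mul, norm_pow, hnu, one_pow, one_mul]
  · rw [show u ^ 1 * taylorCoeff f (1 + 1) * (u ^ 3 * taylorCoeff f (3 + 1)) -
      u ^ 4 * taylorCoeff f (4 + 1) =
        u ^ 4 * (taylorCoeff f 2 * taylorCoeff f 4 - taylorCoeff f 5) by ring]
    rw [norm_mul, norm_pow, hnu, one_pow, one_mul]

theorem mainTheorem2 :
    -- the two bounds
    (∀ f : ℂ → ℂ, ClassU f →
      ‖taylorCoeff f 2 * taylorCoeff f 3 - taylorCoeff f 4‖ ≤ 2 ∧
      ‖taylorCoeff f 2 * taylorCoeff f 4 - taylorCoeff f 5‖ ≤ 3) ∧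
    -- the expansion of the Koebe function
    (∀ z ∈ Metric.ball (0 : ℂ) 1, HasSum (fun n : ℕ => (n : ℂ) * z ^ n) (koebe z)) ∧
    -- sharpness for the Koebe function
    (ClassU koebe ∧
      ‖taylorCoeff koebe 2 * taylorCoeff koebe 3 - taylorCoeff koebe 4‖ = 2 ∧
      ‖taylorCoeff koebe 2 * taylorCoeff koebe 4 - taylorCoeff koebe 5‖ = 3) ∧
    -- sharpness for its rotations
    (∀ θ : ℝ, ClassU (diskRotation θ koebe) ∧
      ‖taylorCoeff (diskRotation θ koebe) 2 * taylorCoeff (diskRotation θ koebe) 3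
        - taylorCoeff (diskRotation θ koebe) 4‖ = 2 ∧
      ‖taylorCoeff (diskRotation θ koebe) 2 * taylorCoeff (diskRotation θ koebe) 4
        - taylorCoeff (diskRotation θ koebe) 5‖ = 3) := by
  have hk : ‖taylorCoeff koebe 2 * taylorCoeff koebe 3 - taylorCoeff koebe 4‖ = 2 ∧
      ‖taylorCoeff koebe 2 * taylorCoeff koebe 4 - taylorCoeff koebe 5‖ = 3 := by
    simp only [taylorCoeff_koebe]
    norm_num
  refine ⟨fun f hf => hf.norm_taylorCoeff_le, fun z hz => hasSum_koebe hz,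
    ⟨classU_koebe, hk⟩, fun θ => ⟨classU_koebe.diskRotation θ, ?_⟩⟩
  have h := norm_taylorCoeff_diskRotation θ koebe
  exact ⟨h.1.trans hk.1, h.2.trans hk.2⟩
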